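/- Let $q$ be a prime power with $q-1=rn$ for positive integers $r,n$, and let $\alpha\in\mathbb F_q^*$ be an element of order $r$. Then for every integer $i$ with $0\le i\le n-2$ and all positive integers $c_1\ge c_2$ with $c_1+c_2=i+1$ there exists an MDS convolutional code with parameters $(n,\,n-c_1,\,c_2;\,1,\,i+2)_q$. Here a convolutional code with parameters $(n,k,\gamma;m,d_f)_q$ is a submodule $C=\{u(D)G(D): u(D)\in\mathbb F_q[D]^k\}$ of $\mathbb F_q[D]^n$ generated by a reduced basic matrix $G(D)=(g_{ij})\in\mathbb F_q[D]^{k\times n}$, where, with $\gamma_i=\max_j\deg g_{ij}$, one has $\gamma=\sum_i\gamma_i$ and $m=\max_i\gamma_i$, and $d_f$ is the minimum weight (total number of nonzero coefficients) of a nonzero element of $C$. The matrix $G$ is basic if it has a polynomial right inverse, and reduced basic if moreover $\sum_i\gamma_i$ is smallest among all basic matrices generating the same code. The code is MDS if it attains the generalized Singleton bound with equality: $d_f=(n-k)\left(\lfloor \gamma/k\rfloor+1\right)+\gamma+1$. -/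

import Mathlib

namespace ConvCode

open Polynomial

variable {F : Type*} [Field F] {n k : ℕ}

/-- The degree `γᵢ` of the `i`-th row of a polynomial matrix: the largest degree of its entries. -/
def rowDegree (G : Matrix (Fin k) (Fin n) F[X]) (i : Fin k) : ℕ :=
  Finset.univ.sup fun j => (G i j).natDegree

/-- The overall constraint length `γ = γ₁ + ⋯ + γₖ` of a polynomial matrix. -/
def constraintLength (G : Matrix (Fin k) (Fin n) F[X]) : ℕ :=
  ∑ i, rowDegree G i

/-- The memory `m = max γᵢ` of a polynomial matrix. -/
def memory (G : Matrix (Fin k) (Fin n) F[X]) : ℕ :=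
  Finset.univ.sup fun i => rowDegree G i

/-- The module `{u(D) G(D) | u(D) ∈ F[D]ᵏ}` generated by the rows of `G`. -/
noncomputable def rowModule (G : Matrix (Fin k) (Fin n) F[X]) : Submodule F[X] (Fin n → F[X]) :=
  LinearMap.range G.vecMulLinear

/-- `G` is basic: it has a polynomial right inverse. -/
def IsBasic (G : Matrix (Fin k) (Fin n) F[X]) : Prop :=
  ∃ R : Matrix (Fin n) (Fin k) F[X], G * R = 1

/-- `G` is reduced basic: it is basic, and its overall constraint length is the smallest among
all basic matrices generating the same code. -/
def IsReducedBasic (G : Matrix (Fin k) (Fin n) F[X]) : Prop :=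
  IsBasic G ∧ ∀ G' : Matrix (Fin k) (Fin n) F[X],
    IsBasic G' → rowModule G' = rowModule G → constraintLength G ≤ constraintLength G'

/-- The weight of a polynomial vector: the total number of nonzero coefficients of its entries. -/
def weight (v : Fin n → F[X]) : ℕ :=
  ∑ j, (v j).support.card

/-- `d` is the free distance of `C`: the minimum weight of a nonzero codeword. -/
def IsFreeDistance (C : Submodule F[X] (Fin n → F[X])) (d : ℕ) : Prop :=
  IsLeast {w | ∃ v ∈ C, v ≠ 0 ∧ weight v = w} d

/-- `C` is a convolutional code with parameters `(n, k, γ; m, d)` over `F`: it is generated by a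
reduced basic `k × n` matrix of overall constraint length `γ` and memory `m`, and its free
distance is `d`. -/
def HasParameters (C : Submodule F[X] (Fin n → F[X])) (k γ m d : ℕ) : Prop :=
  (∃ G : Matrix (Fin k) (Fin n) F[X], IsReducedBasic G ∧ rowModule G = C ∧
    constraintLength G = γ ∧ memory G = m) ∧ IsFreeDistance C d

/-- `C` is an MDS convolutional code with parameters `(n, k, γ; m, d)`: its parameters attain the
generalized Singleton bound `d ≤ (n - k) (⌊γ / k⌋ + 1) + γ + 1`. -/
def IsMDSWithParameters (C : Submodule F[X] (Fin n → F[X])) (k γ m d : ℕ) : Prop :=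
  HasParameters C k γ m d ∧
    (d : ℤ) = ((n : ℤ) - (k : ℤ)) * (((γ / k : ℕ) : ℤ) + 1) + (γ : ℤ) + 1

end ConvCode

namespace ConvCode

open Polynomial Matrix

/-! ### Row degrees, maximal minors and unimodular equivalence -/

section Degrees

variable {F : Type*} [Field F] {n k l : ℕ}

/-! Fix `n` distinct nonzero points `x j` and give a word `v` the syndromes `S_a = ∑ v_j x_j ^ a`
for `a < n`; the Vandermonde matrix makes these invertible coordinates. The code is cut out by `S_s
= -D S_{c₁+s}` for `s < c₂` and `S_s = 0` for `c₂ ≤ s < c₁`.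

Distance: the lowest coefficient vector of a nonzero codeword kills the moments below `c₁`, the
highest kills the `c₂` moments from `c₁` on. By the BCH bound, distinct vectors contribute at least
`(c₁ + 1) + (c₂ + 1)`, and a single vector at least `c₁ + c₂ + 1`. A constant Reed-Solomon word
attains the latter (`lt_weight_of_syndromes`, `exists_moments_eq_zero`).

Reducedness: a constant invertible change of coordinates does not raise row degrees and a unimodular
factor preserves degrees of maximal minors, so one minor of degree `c₂` bounds every competing
generator (`constraintLength_ge_of_minor`). -/

theorem natDegree_le_rowDegree (G : Matrix (Fin k) (Fin n) F[X]) (i : Fin k) (j : Fin n) :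
    (G i j).natDegree ≤ rowDegree G i :=
  Finset.le_sup (f := fun j => (G i j).natDegree) (Finset.mem_univ j)

theorem rowDegree_mul_map_C_le (G : Matrix (Fin k) (Fin n) F[X]) (W : Matrix (Fin n) (Fin l) F)
    (i : Fin k) : rowDegree (G * W.map C) i ≤ rowDegree G i := by
  refine Finset.sup_le fun j _ => ?_
  rw [Matrix.mul_apply]
  refine natDegree_sum_le_of_forall_le _ _ fun a _ => ?_
  exact (natDegree_mul_C_le _ _).trans (natDegree_le_rowDegree G i a)

theorem constraintLength_mul_map_C_le (G : Matrix (Fin k) (Fin n) F[X])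
    (W : Matrix (Fin n) (Fin l) F) : constraintLength (G * W.map C) ≤ constraintLength G :=
  Finset.sum_le_sum fun i _ => rowDegree_mul_map_C_le G W i

/-- The degree of a maximal minor is at most the overall constraint length. -/
theorem natDegree_det_submatrix_le (G : Matrix (Fin k) (Fin n) F[X]) (σ : Fin k → Fin n) :
    (G.submatrix id σ).det.natDegree ≤ constraintLength G := by
  rw [← Matrix.det_transpose, Matrix.det_apply]
  refine natDegree_sum_le_of_forall_le _ _ fun τ _ => ?_
  refine (natDegree_smul_le _ _).trans ((natDegree_prod_le _ _).trans ?_)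
  exact Finset.sum_le_sum fun i _ => natDegree_le_rowDegree G i _

theorem exists_eq_mul_of_rowModule_le {G : Matrix (Fin k) (Fin n) F[X]}
    {H : Matrix (Fin l) (Fin n) F[X]} (h : rowModule H ≤ rowModule G) :
    ∃ U : Matrix (Fin l) (Fin k) F[X], H = U * G := by
  have hrow : ∀ i, ∃ u : Fin k → F[X], u ᵥ* G = H i := fun i => by
    obtain ⟨u, hu⟩ := h ⟨Pi.single i 1, rfl⟩
    refine ⟨u, ?_⟩
    simpa [Matrix.row] using hu
  choose U hU using hrow
  refine ⟨U, ?_⟩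
  exact Matrix.ext fun i j => (congrFun (hU i) j).symm

/-- Two matrices with the same row module, the second one basic, differ by a unimodular factor. -/
theorem exists_isUnit_det_of_rowModule_eq {G H : Matrix (Fin k) (Fin n) F[X]} (hG : IsBasic G)
    (h : rowModule H = rowModule G) :
    ∃ U : Matrix (Fin k) (Fin k) F[X], IsUnit U.det ∧ H = U * G := by
  obtain ⟨U, hU⟩ := exists_eq_mul_of_rowModule_le h.le
  obtain ⟨V, hV⟩ := exists_eq_mul_of_rowModule_le h.ge
  obtain ⟨R, hR⟩ := hG
  refine ⟨U, ?_, hU⟩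
  have hVU : V * U = 1 := by
    have h1 : V * U * (G * R) = G * R := by
      rw [← Matrix.mul_assoc, Matrix.mul_assoc V, ← hU, ← hV]
    simpa [hR] using h1
  exact IsUnit.of_mul_eq_one_right V.det (by rw [← Matrix.det_mul, hVU, Matrix.det_one])

/-- A basic matrix `A * W`, with `W` constant and invertible, is reduced as soon as some maximal
minor of `A` has degree at least its overall constraint length. -/
theorem constraintLength_ge_of_minor {A G' : Matrix (Fin k) (Fin n) F[X]}
    {V W : Matrix (Fin n) (Fin n) F} (hWV : W * V = 1) (hG : IsBasic (A * W.map C))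
    (h : rowModule G' = rowModule (A * W.map C)) (σ : Fin k → Fin n) :
    (A.submatrix id σ).det.natDegree ≤ constraintLength G' := by
  obtain ⟨U, hU, rfl⟩ := exists_isUnit_det_of_rowModule_eq hG h
  have hWV' : W.map C * V.map C = (1 : Matrix (Fin n) (Fin n) F[X]) := by
    rw [← Matrix.map_mul, hWV, Matrix.map_one _ C.map_zero C.map_one]
  -- Undoing `W` turns the competitor into `U * A`, whose minors are those of `A` times the nonzero
  -- constant `det U`.
  refine le_trans ?_ (constraintLength_mul_map_C_le _ V)
  refine le_trans (le_of_eq ?_) (natDegree_det_submatrix_le _ σ)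
  have hsub : ((U * (A * W.map C)) * V.map C).submatrix id σ = U * A.submatrix id σ := by
    rw [Matrix.mul_assoc, Matrix.mul_assoc, hWV', Matrix.mul_one]
    rfl
  rw [hsub, Matrix.det_mul]
  obtain ⟨c, hc, hcU⟩ := Polynomial.isUnit_iff.1 hU
  rw [← hcU, natDegree_C_mul hc.ne_zero]

end Degrees

/-! ### BCH bound and weights of codewords -/

section Weights

variable {F : Type*} [Field F] {n : ℕ}

/-- The BCH bound for generalized Reed-Solomon codes. -/
theorem lt_card_support_of_moments_eq_zero [DecidableEq F] {x : Fin n → F}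
    (hx : Function.Injective x) (hx0 : ∀ j, x j ≠ 0) {w : Fin n → F} (hw : w ≠ 0) {e c : ℕ}
    (h : ∀ s < c, ∑ j, w j * x j ^ (e + s) = 0) :
    c < (Finset.univ.filter fun j => w j ≠ 0).card := by
  by_contra! hc
  obtain ⟨j₀, hj₀⟩ := Function.ne_iff.1 hw
  set T := (Finset.univ.filter fun j => w j ≠ 0) with hT
  have hjT : j₀ ∈ T := by simpa [hT] using hj₀
  -- Vanishes at every support point except `x j₀`. Its degree is below `c`, so pairing it with `w`
  -- uses only vanishing moments.
  let p : F[X] := ∏ j ∈ T.erase j₀, (X - C (x j))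
  have hdeg : p.natDegree < c := by
    rw [natDegree_prod_of_monic _ _ fun j _ => monic_X_sub_C _]
    simp only [natDegree_X_sub_C, Finset.sum_const, smul_eq_mul, mul_one]
    exact (Finset.card_erase_lt_of_mem hjT).trans_le hc
  have hzero : ∑ j, w j * x j ^ e * p.eval (x j) = 0 := by
    calc ∑ j, w j * x j ^ e * p.eval (x j)
        = ∑ s ∈ Finset.range c, p.coeff s * ∑ j, w j * x j ^ (e + s) := by
          simp_rw [eval_eq_sum_range' hdeg, Finset.mul_sum]
          rw [Finset.sum_comm]
          refine Finset.sum_congr rfl fun s _ => Finset.sum_congr rfl fun j _ => ?_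
          ring
      _ = 0 := Finset.sum_eq_zero fun s hs => by rw [h s (Finset.mem_range.1 hs), mul_zero]
  rw [Finset.sum_eq_single j₀] at hzero
  · refine mul_ne_zero (mul_ne_zero hj₀ (pow_ne_zero _ (hx0 j₀))) ?_ hzero
    rw [eval_prod]
    refine Finset.prod_ne_zero_iff.2 fun j hj => ?_
    simpa [sub_eq_zero] using fun h => (Finset.ne_of_mem_erase hj) (hx h).symm
  · intro j _ hj
    by_cases hwj : w j = 0
    · simp [hwj]
    · have : p.eval (x j) = 0 := by
        rw [eval_prod]
        exact Finset.prod_eq_zero (i := j) (by simp [hT, hj, hwj]) (by simp)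
      rw [this, mul_zero]
  · simp

theorem weight_ge_sum_card [DecidableEq F] (v : Fin n → F[X]) (T : Finset ℕ) :
    ∑ t ∈ T, (Finset.univ.filter fun j => (v j).coeff t ≠ 0).card ≤ weight v := by
  simp_rw [weight, Finset.card_filter]
  rw [Finset.sum_comm]
  refine Finset.sum_le_sum fun j _ => ?_
  rw [← Finset.card_filter]
  refine Finset.card_le_card fun t ht => ?_
  simpa using (Finset.mem_filter.1 ht).2

theorem weight_C [DecidableEq F] (w : Fin n → F) :
    weight (fun j => C (w j)) = (Finset.univ.filter fun j => w j ≠ 0).card := by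
  rw [weight, Finset.card_filter]
  refine Finset.sum_congr rfl fun j _ => ?_
  by_cases h : w j = 0
  · simp [h]
  · simp [h, support_C h]

/-- Codewords whose syndromes vanish up to the unit-memory relations have weight larger than
`c₁ + c₂`. -/
theorem lt_weight_of_syndromes {x : Fin n → F}
    (hx : Function.Injective x) (hx0 : ∀ j, x j ≠ 0) {v : Fin n → F[X]} (hv : v ≠ 0) {c₁ c₂ : ℕ}
    (h₁ : ∀ s < c₂, ∑ j, v j * C (x j) ^ s = -X * ∑ j, v j * C (x j) ^ (c₁ + s))
    (h₂ : ∀ s, c₂ ≤ s → s < c₁ → ∑ j, v j * C (x j) ^ s = 0) :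
    c₁ + c₂ < weight v := by
  classical
  have hcoeff : ∀ s t, (∑ j, v j * C (x j) ^ s).coeff t = ∑ j, (v j).coeff t * x j ^ s := by
    intro s t
    simp_rw [finsetSum_coeff, ← C_pow, coeff_mul_C]
  let T : Finset ℕ := Finset.univ.biUnion fun j => (v j).support
  have hT : ∀ t, t ∈ T ↔ (fun j => (v j).coeff t) ≠ 0 := fun t => by
    simp [T, Function.ne_iff]
  have hTne : T.Nonempty := by
    obtain ⟨j, hj⟩ := Function.ne_iff.1 hv
    obtain ⟨t, ht⟩ := nonempty_support_iff.2 hj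
    exact ⟨t, Finset.mem_biUnion.2 ⟨j, Finset.mem_univ j, ht⟩⟩
  obtain ⟨a, ha, hmin⟩ := T.exists_min_image id hTne
  obtain ⟨b, hb, hmax⟩ := T.exists_max_image id hTne
  have hbefore : ∀ t < a, ∀ j, (v j).coeff t = 0 := fun t ht j => by
    by_contra hne
    exact absurd (hmin t ((hT t).2 (Function.ne_iff.2 ⟨j, hne⟩))) (not_le.2 ht)
  have hafter : ∀ t, b < t → ∀ j, (v j).coeff t = 0 := fun t ht j => by
    by_contra hne
    exact absurd (hmax t ((hT t).2 (Function.ne_iff.2 ⟨j, hne⟩))) (not_le.2 ht)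
  have hlow : ∀ s < c₁, ∑ j, (v j).coeff a * x j ^ s = 0 := by
    intro s hs
    rw [← hcoeff]
    by_cases hs₂ : s < c₂
    -- The factor `X` shifts to time `a - 1`, before the word starts.
    · rw [h₁ s hs₂, neg_mul, coeff_neg, neg_eq_zero]
      cases a with
      | zero => simp
      | succ a =>
        rw [coeff_X_mul, hcoeff]
        exact Finset.sum_eq_zero fun j _ => by rw [hbefore a (Nat.lt_succ_self a), zero_mul]
    · rw [h₂ s (not_lt.1 hs₂) hs, coeff_zero]
  have hhigh : ∀ s < c₂, ∑ j, (v j).coeff b * x j ^ (c₁ + s) = 0 := by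
    intro s hs
    -- At time `b + 1` the left side has ended, while the right side shows the coefficient at time
    -- `b`.
    have := congrArg (fun p => coeff p (b + 1)) (h₁ s hs)
    simp only [neg_mul, coeff_neg, coeff_X_mul, hcoeff] at this
    rw [← neg_eq_zero, ← this]
    exact Finset.sum_eq_zero fun j _ => by rw [hafter (b + 1) (Nat.lt_succ_self b), zero_mul]
  by_cases hab : a = b
  · subst hab
    have hcard := lt_card_support_of_moments_eq_zero hx hx0 ((hT a).1 ha) (e := 0) (c := c₁ + c₂)
      fun s hs => by
        rw [zero_add]
        by_cases hs₁ : s < c₁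
        · exact hlow s hs₁
        · have := hhigh (s - c₁) (by omega)
          rwa [Nat.add_sub_cancel' (not_lt.1 hs₁)] at this
    have := weight_ge_sum_card v {a}
    rw [Finset.sum_singleton] at this
    exact hcard.trans_le this
  · have hA := lt_card_support_of_moments_eq_zero hx hx0 ((hT a).1 ha) (e := 0) (c := c₁)
      fun s hs => by rw [zero_add]; exact hlow s hs
    have hB := lt_card_support_of_moments_eq_zero hx hx0 ((hT b).1 hb) hhigh
    have := weight_ge_sum_card v {a, b}
    rw [Finset.sum_pair hab] at this
    omega

/-- Some word of support size at most `c + 1` has `c` vanishing moments. -/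
theorem exists_moments_eq_zero [DecidableEq F] (x : Fin n → F) {c : ℕ} (hc : c < n) :
    ∃ w : Fin n → F, w ≠ 0 ∧ (∀ s < c, ∑ j, w j * x j ^ s = 0) ∧
      (Finset.univ.filter fun j => w j ≠ 0).card ≤ c + 1 := by
  -- On the first `c + 1` positions there are `c` linear equations in `c + 1` unknowns.
  let ι : Fin (c + 1) → Fin n := Fin.castLE hc
  let M : Matrix (Fin (c + 1)) (Fin c) F := Matrix.of fun j s => x (ι j) ^ (s : ℕ)
  have hker : LinearMap.ker M.vecMulLinear ≠ ⊥ :=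
    LinearMap.ker_ne_bot_of_finrank_lt (by simp)
  obtain ⟨u, hu, hu0⟩ := Submodule.exists_mem_ne_zero_of_ne_bot hker
  have hι : Function.Injective ι := Fin.castLE_injective hc
  refine ⟨Function.extend ι u 0, ?_, fun s hs => ?_, ?_⟩
  · obtain ⟨j, hj⟩ := Function.ne_iff.1 hu0
    exact Function.ne_iff.2 ⟨ι j, by simpa [hι.extend_apply] using hj⟩
  · have h := congrFun (LinearMap.mem_ker.1 hu) ⟨s, hs⟩
    rw [← Finset.sum_subset (Finset.subset_univ (Finset.univ.map ⟨ι, hι⟩)), Finset.sum_map]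
    · simpa [hι.extend_apply, M, Matrix.vecMul, dotProduct] using h
    · intro j _ hj
      rw [Function.extend_apply' _ _ _ fun ⟨i, hi⟩ => hj (by simp [← hi]), Pi.zero_apply, zero_mul]
  · calc _ ≤ (Finset.univ.map ⟨ι, hι⟩).card := Finset.card_le_card fun j hj => by
          by_contra hj'
          refine (Finset.mem_filter.1 hj).2 ?_
          exact Function.extend_apply' _ _ _ fun ⟨i, hi⟩ => hj' (by simp [← hi])
      _ = c + 1 := by simp

end Weights

/-! ### The generator matrix and its parameters -/

section Construction

variable (F : Type*) [Field F]

/-- The generator matrix in syndrome coordinates: row `s` has `1` in column `c₁ + s` and, if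
`s < c₂`, the entry `-D` in column `s`. -/
noncomputable def syndromeGenerator (n c₁ c₂ : ℕ) : Matrix (Fin (n - c₁)) (Fin n) F[X] :=
  Matrix.of fun s a =>
    if (a : ℕ) = c₁ + s then 1 else if (a : ℕ) = s ∧ (s : ℕ) < c₂ then -X else 0

variable {F} {n c₁ c₂ : ℕ}

theorem rowDegree_syndromeGenerator_le (s : Fin (n - c₁)) :
    rowDegree (syndromeGenerator F n c₁ c₂) s ≤ if (s : ℕ) < c₂ then 1 else 0 := by
  refine Finset.sup_le fun a _ => ?_
  simp only [syndromeGenerator, Matrix.of_apply]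
  split_ifs <;> simp_all

theorem constraintLength_syndromeGenerator_le :
    constraintLength (syndromeGenerator F n c₁ c₂) ≤ c₂ := by
  refine (Finset.sum_le_sum fun s _ => rowDegree_syndromeGenerator_le s).trans ?_
  rw [← Finset.card_filter]
  calc _ ≤ (Finset.range c₂).card :=
        Finset.card_le_card_of_injOn (fun s : Fin (n - c₁) => (s : ℕ))
          (fun s hs => by simpa using hs) (Fin.val_injective.injOn)
    _ = c₂ := Finset.card_range c₂

/-- Since `c₂ ≤ c₁`, the `-D` entries lie left of column `c₁`, so the columns from `c₁` on form an
identity block. -/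
theorem vecMul_syndromeGenerator_add (u : Fin (n - c₁) → F[X]) (s : Fin (n - c₁)) (a : Fin n)
    (ha : (a : ℕ) = c₁ + s) (hle : c₂ ≤ c₁) : (u ᵥ* syndromeGenerator F n c₁ c₂) a = u s := by
  rw [Matrix.vecMul, dotProduct, Finset.sum_eq_single s]
  · simp [syndromeGenerator, ha]
  · intro t _ hts
    have h1 : ¬ (a : ℕ) = c₁ + t := fun h => hts (Fin.ext (by omega))
    have h2 : ¬ ((a : ℕ) = t ∧ (t : ℕ) < c₂) := by omega
    simp only [syndromeGenerator, Matrix.of_apply, if_neg h1, if_neg h2, mul_zero]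
  · simp

theorem vecMul_syndromeGenerator_of_lt (u : Fin (n - c₁) → F[X]) (s : Fin (n - c₁)) (a : Fin n)
    (ha : (a : ℕ) = s) (hs : (s : ℕ) < c₂) (hle : c₂ ≤ c₁) :
    (u ᵥ* syndromeGenerator F n c₁ c₂) a = -X * u s := by
  rw [Matrix.vecMul, dotProduct, Finset.sum_eq_single s]
  · have h1 : ¬ (a : ℕ) = c₁ + s := by omega
    simp only [syndromeGenerator, Matrix.of_apply, if_neg h1, if_pos (And.intro ha hs)]
    ring
  · intro t _ hts
    have h1 : ¬ (a : ℕ) = c₁ + t := by omega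
    have h2 : ¬ ((a : ℕ) = t ∧ (t : ℕ) < c₂) := fun h => hts (Fin.ext (by omega))
    simp only [syndromeGenerator, Matrix.of_apply, if_neg h1, if_neg h2, mul_zero]
  · simp

theorem vecMul_syndromeGenerator_of_le (u : Fin (n - c₁) → F[X]) (a : Fin n)
    (ha : c₂ ≤ (a : ℕ)) (ha' : (a : ℕ) < c₁) :
    (u ᵥ* syndromeGenerator F n c₁ c₂) a = 0 := by
  rw [Matrix.vecMul, dotProduct]
  refine Finset.sum_eq_zero fun t _ => ?_
  have h1 : ¬ (a : ℕ) = c₁ + t := by omega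
  have h2 : ¬ ((a : ℕ) = t ∧ (t : ℕ) < c₂) := by omega
  simp only [syndromeGenerator, Matrix.of_apply, if_neg h1, if_neg h2, mul_zero]

theorem isBasic_syndromeGenerator_mul (hle : c₂ ≤ c₁) {V W : Matrix (Fin n) (Fin n) F}
    (hWV : W * V = 1) : IsBasic (syndromeGenerator F n c₁ c₂ * W.map C) := by
  -- Selecting the identity block inverts the generator on the right once `W` is undone.
  let ι : Fin (n - c₁) → Fin n := fun s => ⟨c₁ + s, by omega⟩
  refine ⟨V.map C * (1 : Matrix (Fin n) (Fin n) F[X]).submatrix id ι, ?_⟩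
  have hWV' : W.map C * V.map C = (1 : Matrix (Fin n) (Fin n) F[X]) := by
    rw [← Matrix.map_mul, hWV, Matrix.map_one _ C.map_zero C.map_one]
  rw [Matrix.mul_assoc, ← Matrix.mul_assoc (W.map C), hWV', Matrix.one_mul]
  have : syndromeGenerator F n c₁ c₂ * (1 : Matrix (Fin n) (Fin n) F[X]).submatrix id ι =
      (syndromeGenerator F n c₁ c₂ * (1 : Matrix (Fin n) (Fin n) F[X])).submatrix id ι := rfl
  rw [this, Matrix.mul_one]
  refine Matrix.ext fun s t => ?_
  have h := vecMul_syndromeGenerator_add (F := F) (c₂ := c₂) (Pi.single s 1) t (ι t) rfl hle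
  rw [Matrix.single_one_vecMul] at h
  rw [Matrix.one_apply, Matrix.submatrix_apply]
  refine h.trans ?_
  rw [Pi.single_apply]
  simp only [eq_comm]

theorem exists_minor_syndromeGenerator (hle : c₂ ≤ c₁) (hn : c₁ + c₂ < n) :
    ∃ σ : Fin (n - c₁) → Fin n,
      ((syndromeGenerator F n c₁ c₂).submatrix id σ).det.natDegree = c₂ := by
  -- Row `t` is represented by its `-D` column if it has one, else by its `1`; the minor is
  -- diagonal. All `c₂` such rows exist because `c₂ < n - c₁`.
  refine ⟨fun t => if (t : ℕ) < c₂ then ⟨t, by omega⟩ else ⟨c₁ + t, by omega⟩, ?_⟩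
  have hdiag : (syndromeGenerator F n c₁ c₂).submatrix id
      (fun t : Fin (n - c₁) => if (t : ℕ) < c₂ then (⟨t, by omega⟩ : Fin n) else ⟨c₁ + t, by omega⟩)
      = Matrix.diagonal fun t : Fin (n - c₁) => if (t : ℕ) < c₂ then -X else 1 := by
    refine Matrix.ext fun s t => ?_
    rw [Matrix.diagonal_apply, Matrix.submatrix_apply]
    simp only [syndromeGenerator, Matrix.of_apply, id, Fin.ext_iff]
    by_cases ht : (t : ℕ) < c₂
    · rw [if_pos ht]
      have h1 : ¬ (t : ℕ) = c₁ + s := by omega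
      rw [if_neg h1]
      by_cases hst : (s : ℕ) = t
      · simp [hst, ht]
      · rw [if_neg hst, if_neg (show ¬ ((t : ℕ) = s ∧ (s : ℕ) < c₂) by omega)]
    · rw [if_neg ht]
      by_cases hst : (s : ℕ) = t
      · simp [hst, ht]
      · rw [if_neg hst, if_neg (show ¬ c₁ + (t : ℕ) = c₁ + s by omega),
          if_neg (show ¬ (c₁ + (t : ℕ) = s ∧ (s : ℕ) < c₂) by omega)]
  rw [hdiag, Matrix.det_diagonal, Finset.prod_ite, Finset.prod_const, Finset.prod_const_one,
    mul_one, natDegree_pow, natDegree_neg, natDegree_X, mul_one]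
  calc _ = ((Finset.univ.filter fun t : Fin (n - c₁) => (t : ℕ) < c₂).map
        Fin.valEmbedding).card := (Finset.card_map _).symm
    _ = (Finset.range c₂).card := by
        congr 1
        ext t
        simp only [Finset.mem_map, Finset.mem_filter, Finset.mem_univ, true_and,
          Fin.valEmbedding_apply, Finset.mem_range]
        exact ⟨fun ⟨a, ha, hat⟩ => hat ▸ ha, fun ht => ⟨⟨t, by omega⟩, ht, rfl⟩⟩
    _ = c₂ := Finset.card_range c₂

theorem isReducedBasic_syndromeGenerator_mul (hle : c₂ ≤ c₁) (hn : c₁ + c₂ < n)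
    {V W : Matrix (Fin n) (Fin n) F} (hWV : W * V = 1) :
    IsReducedBasic (syndromeGenerator F n c₁ c₂ * W.map C) ∧
      constraintLength (syndromeGenerator F n c₁ c₂ * W.map C) = c₂ := by
  have hG : IsBasic (syndromeGenerator F n c₁ c₂ * W.map C) :=
    isBasic_syndromeGenerator_mul hle hWV
  obtain ⟨σ, hσ⟩ := exists_minor_syndromeGenerator (F := F) hle hn
  have hub := (constraintLength_mul_map_C_le _ W).trans
    (constraintLength_syndromeGenerator_le (F := F) (n := n) (c₁ := c₁) (c₂ := c₂))
  have hlb := fun {G'} (h : rowModule G' = _) => hσ ▸ constraintLength_ge_of_minor hWV hG h σ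
  exact ⟨⟨hG, fun G' _ h => hub.trans (hlb h)⟩, hub.antisymm (hlb rfl)⟩

theorem memory_syndromeGenerator_mul (hle : c₂ ≤ c₁) (hn : c₁ + c₂ < n) (hc₂ : 0 < c₂)
    {V W : Matrix (Fin n) (Fin n) F} (hWV : W * V = 1) :
    memory (syndromeGenerator F n c₁ c₂ * W.map C) = 1 := by
  refine le_antisymm (Finset.sup_le fun s _ => ?_) ?_
  · refine (rowDegree_mul_map_C_le _ W s).trans ((rowDegree_syndromeGenerator_le s).trans ?_)
    split_ifs <;> simp
  · by_contra! h
    have h0 : constraintLength (syndromeGenerator F n c₁ c₂ * W.map C) = 0 :=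
      Finset.sum_eq_zero fun s hs => Nat.lt_one_iff.1
        ((Finset.le_sup (f := rowDegree (syndromeGenerator F n c₁ c₂ * W.map C)) hs).trans_lt h)
    rw [(isReducedBasic_syndromeGenerator_mul hle hn hWV).2] at h0
    omega

theorem isFreeDistance_syndromeGenerator_mul (hle : c₂ ≤ c₁) (hn : c₁ + c₂ < n)
    {x : Fin n → F} (hx : Function.Injective x) (hx0 : ∀ j, x j ≠ 0) :
    IsFreeDistance (rowModule (syndromeGenerator F n c₁ c₂ * (vandermonde x)⁻¹.map C))
      (c₁ + c₂ + 1) := by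
  classical
  have hdet : IsUnit (vandermonde x).det := (det_vandermonde_ne_zero_iff.2 hx).isUnit
  have hWV : (vandermonde x)⁻¹.map C * (vandermonde x).map C = (1 : Matrix _ _ F[X]) := by
    rw [← Matrix.map_mul, nonsing_inv_mul _ hdet, Matrix.map_one _ C.map_zero C.map_one]
  have hsyn : ∀ (v : Fin n → F[X]) (a : Fin n),
      (v ᵥ* (vandermonde x).map C) a = ∑ j, v j * C (x j) ^ (a : ℕ) := fun v a => by
    simp [Matrix.vecMul, dotProduct, vandermonde_apply]
  have hlower : ∀ v ∈ rowModule (syndromeGenerator F n c₁ c₂ * (vandermonde x)⁻¹.map C), v ≠ 0 →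
      c₁ + c₂ + 1 ≤ weight v := by
    rintro v ⟨u, hu⟩ hv
    have huv : v ᵥ* (vandermonde x).map C = u ᵥ* syndromeGenerator F n c₁ c₂ := by
      rw [← hu, Matrix.vecMulLinear_apply, Matrix.vecMul_vecMul, Matrix.mul_assoc, hWV,
        Matrix.mul_one]
    refine lt_weight_of_syndromes hx hx0 hv (fun s hs => ?_) fun s hs hs' => ?_
    · have h₁ := hsyn v ⟨s, by omega⟩
      have h₂ := hsyn v ⟨c₁ + s, by omega⟩
      rw [huv] at h₁ h₂
      rw [vecMul_syndromeGenerator_of_lt u ⟨s, by omega⟩ _ rfl hs hle] at h₁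
      rw [vecMul_syndromeGenerator_add u ⟨s, by omega⟩ _ rfl hle] at h₂
      rw [← h₁, ← h₂]
    · have h₁ := hsyn v ⟨s, by omega⟩
      rwa [huv, vecMul_syndromeGenerator_of_le u _ hs hs', eq_comm] at h₁
  refine ⟨?_, fun d ⟨v, hv, hv0, hd⟩ => hd ▸ hlower v hv hv0⟩
  obtain ⟨w, hw0, hw, hcard⟩ := exists_moments_eq_zero x hn
  have hne : (fun j => C (w j)) ≠ (0 : Fin n → F[X]) := by
    obtain ⟨j, hj⟩ := Function.ne_iff.1 hw0
    exact Function.ne_iff.2 ⟨j, by simpa using hj⟩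
  have hmem : (fun j => C (w j)) ∈
      rowModule (syndromeGenerator F n c₁ c₂ * (vandermonde x)⁻¹.map C) := by
    let S : Fin n → F[X] := (fun j => C (w j)) ᵥ* (vandermonde x).map C
    have hS : ∀ a : Fin n, (a : ℕ) < c₁ + c₂ → S a = 0 := fun a ha => by
      have := congrArg C (hw a ha)
      simpa [S, hsyn] using this
    -- The message is the tail of the syndromes; its first `c₂` entries vanish, so no `-D` term
    -- appears.
    let u : Fin (n - c₁) → F[X] := fun s => S ⟨c₁ + s, by omega⟩
    have huS : u ᵥ* syndromeGenerator F n c₁ c₂ = S := by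
      ext1 a
      by_cases h₁ : (a : ℕ) < c₂
      · rw [vecMul_syndromeGenerator_of_lt u ⟨a, by omega⟩ a rfl h₁ hle, hS a (by omega)]
        simp only [u]
        rw [hS _ (by simpa using h₁), mul_zero]
      · by_cases h₂ : (a : ℕ) < c₁
        · rw [vecMul_syndromeGenerator_of_le u a (not_lt.1 h₁) h₂, hS a (by omega)]
        · have ha : (a : ℕ) = c₁ + (a - c₁) := by omega
          rw [vecMul_syndromeGenerator_add u ⟨a - c₁, by omega⟩ a ha hle]
          exact congrArg S (Fin.ext ha.symm)
    refine ⟨u, ?_⟩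
    have hVW : (vandermonde x).map C * (vandermonde x)⁻¹.map C = (1 : Matrix _ _ F[X]) := by
      rw [← Matrix.map_mul, mul_nonsing_inv _ hdet, Matrix.map_one _ C.map_zero C.map_one]
    rw [Matrix.vecMulLinear_apply, ← Matrix.vecMul_vecMul, huS, Matrix.vecMul_vecMul, hVW,
      Matrix.vecMul_one]
  exact ⟨_, hmem, hne, ((weight_C w).trans_le hcard).antisymm (hlower _ hmem hne)⟩

end Construction

end ConvCode

open ConvCode in
theorem mainTheorem10 {F : Type*} [Field F] [Fintype F] (q r n : ℕ)
    (hF : Fintype.card F = q) (hq : q - 1 = r * n)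
    (α : Fˣ) (hα : orderOf α = r)
    (i c₁ c₂ : ℕ) (hi : i + 2 ≤ n) (hc₁ : 0 < c₁) (hc₂ : 0 < c₂)
    (hsum : i + 1 = c₁ + c₂) (hle : c₂ ≤ c₁) :
    ∃ C : Submodule (Polynomial F) (Fin n → Polynomial F),
      ConvCode.IsMDSWithParameters C (n - c₁) c₂ 1 (i + 2) := by
  classical
  have hr : 0 < r := hα ▸ orderOf_pos α
  have hcard : Fintype.card (Fin n) ≤ Fintype.card Fˣ := by
    rw [Fintype.card_fin, Fintype.card_units, hF, hq]
    exact Nat.le_mul_of_pos_left n hr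
  obtain ⟨y⟩ := Function.Embedding.nonempty_of_card_le hcard
  let x : Fin n → F := fun j => (y j : F)
  have hx : Function.Injective x := Units.val_injective.comp y.injective
  have hx0 : ∀ j, x j ≠ 0 := fun j => (y j).ne_zero
  have hn : c₁ + c₂ < n := by omega
  have hWV := Matrix.nonsing_inv_mul _ (Matrix.det_vandermonde_ne_zero_iff.2 hx).isUnit
  obtain ⟨hred, hlen⟩ := isReducedBasic_syndromeGenerator_mul hle hn hWV
  refine ⟨_, ⟨⟨_, hred, rfl, hlen, memory_syndromeGenerator_mul hle hn hc₂ hWV⟩, ?_⟩, ?_⟩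
  · rw [show i + 2 = c₁ + c₂ + 1 by omega]
    exact isFreeDistance_syndromeGenerator_mul hle hn hx hx0
  -- The floor in the Singleton bound is `0`, so the bound is `c₁ + c₂ + 1`.
  · rw [Nat.div_eq_of_lt (show c₂ < n - c₁ by omega)]
    push_cast [show c₁ ≤ n by omega]
    omega
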